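/- Let $\mathbb F$ be a field. A *$d$-mode tensor* over $\mathbb F$ is a set-multilinear polynomial $T=\sum_{i_1,\dots,i_d} t_{i_1,\dots,i_d}\,x^{(1)}_{i_1}\cdots x^{(d)}_{i_d}$ in $d$ disjoint finite sets of indeterminates (its modes); $(\mathbb F^n)^{\otimes d}$ denotes the $d$-mode tensors all of whose modes have $n$ indeterminates. The *Kronecker product* $T\otimes U$ of two $d$-mode tensors with coefficients $t_{i_1,\dots,i_d}$ and $u_{j_1,\dots,j_d}$ is the $d$-mode tensor $\sum t_{i_1,\dots,i_d}u_{j_1,\dots,j_d}\,z^{(1)}_{(i_1,j_1)}\cdots z^{(d)}_{(i_d,j_d)}$. An *arithmetic circuit* is a finite directed acyclic graph (parallel edges allowed) whose sources (inputs) are labeled by indeterminates or elements of $\mathbb F$, whose other vertices (gates, of arbitrary fan-in) are labeled by $+$ or $\times$, and whose edges (wires) are labeled by elements of $\mathbb F$ by which the transported polynomial is multiplied; its *size* is the number of its wires, and it computes the polynomials at its sinks. The *circuit complexity* $\mathrm{CC}(T)$ is the smallest size of an arithmetic circuit over $\mathbb F$ computing the polynomial $T$. The *rank* $\mathrm R(T)$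 is the smallest number of tensors of the form $\ell_1\cdots\ell_d$, with $\ell_j$ a linear form in the $j$-th mode, whose sum is $T$. The *exponent of matrix multiplication* over $\mathbb F$ is $$\omega=\inf\Bigl\{\beta\in\mathbb R:\ \mathrm R\Bigl(\sum_{i,j,k=1}^n x_{ij}\,y_{jk}\,z_{ki}\Bigr)=O(n^\beta)\Bigr\}.$$ **Theorem (Fast matrix multiplication under submultiplicativity).** Suppose that circuit complexity is submultiplicative on $4$-mode tensors over $\mathbb F$, that is, $$\mathrm{CC}(T\otimes U)\le \mathrm{CC}(T)\cdot\mathrm{CC}(U)\qquad\text{for all } n\ge 1\text{ and all } T,U\in(\mathbb F^n)^{\otimes 4}.$$ Then $\omega=2$. -/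

import Mathlib

noncomputable section

namespace TensorComplexity

/-! ### Tensors in coordinates -/

/-- A `d`-mode tensor over `F` whose `j`-th mode has its indeterminates indexed by `ι j`, given by
its coefficients: `T p` is the coefficient of the set-multilinear monomial `∏ j, x_{j, p j}`. -/
abbrev Tensor (F : Type*) {d : ℕ} (ι : Fin d → Type) : Type _ :=
  (∀ j, ι j) → F

variable {F : Type*} [Field F] {d : ℕ}

/-- The set-multilinear polynomial `∑ p, T p * ∏ j, x_{j, p j}` which a tensor stands for. -/
def Tensor.toPoly {ι : Fin d → Type} [∀ j, Fintype (ι j)] (T : Tensor F ι) :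
    MvPolynomial (Σ j, ι j) F :=
  ∑ p : (∀ j, ι j), MvPolynomial.C (T p) * ∏ j, MvPolynomial.X ⟨j, p j⟩

/-- The Kronecker product: the polynomial product of `S` and `T`, where `x_{j, a} * y_{j, b}` is
read as one indeterminate `z_{j, (a, b)}` of the `j`-th mode `ι j × κ j`. -/
def Tensor.kron {ι κ : Fin d → Type} (S : Tensor F ι) (T : Tensor F κ) :
    Tensor F (fun j => ι j × κ j) :=
  fun p => S (fun j => (p j).1) * T (fun j => (p j).2)

/-- A nonzero tensor has rank one if it is a product of linear forms, one for each mode. -/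
def Tensor.IsRankOne {ι : Fin d → Type} (T : Tensor F ι) : Prop :=
  T ≠ 0 ∧ ∃ l : (∀ j, ι j → F), ∀ p, T p = ∏ j, l j (p j)

/-- The rank of `T`: the least number of rank-one tensors whose sum is `T`. -/
def Tensor.rank {ι : Fin d → Type} (T : Tensor F ι) : ℕ :=
  sInf {r : ℕ | ∃ S : Fin r → Tensor F ι, (∀ i, (S i).IsRankOne) ∧ T = ∑ i, S i}

/-! ### Arithmetic circuits -/

/-- Labels of the vertices of an arithmetic circuit: inputs are labelled by a scalar or by an
indeterminate, all other gates by `+` or `×`. -/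
inductive Label (F X : Type*) where
  | const (c : F)
  | var (x : X)
  | add
  | mul

/-- The label is that of an input. -/
def Label.IsInput {F X : Type*} : Label F X → Prop
  | .const _ => True
  | .var _ => True
  | .add => False
  | .mul => False

/-- An arithmetic circuit over `F[X]`: a finite directed acyclic graph (fan-in and fan-out are
unbounded, parallel wires are allowed) whose sources are exactly the inputs and whose wires are
labelled by scalars. -/
structure Circuit (F X : Type*) where
  /-- the gates -/
  V : Type
  /-- the wires -/
  W : Type
  [fintypeV : Fintype V]
  [fintypeW : Fintype W]
  /-- the tail of a wire -/
  src : W → V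
  /-- the head of a wire -/
  tgt : W → V
  /-- the labels of the gates -/
  label : V → Label F X
  /-- the labels of the wires -/
  scalar : W → F
  acyclic : ∀ v, ¬ Relation.TransGen (fun a b => ∃ w, src w = a ∧ tgt w = b) v v
  input_iff_source : ∀ v, (label v).IsInput ↔ ∀ w, tgt w ≠ v

attribute [instance] Circuit.fintypeV Circuit.fintypeW

namespace Circuit

variable {X : Type*}

/-- The size of a circuit is the number of its wires. -/
def size (C : Circuit F X) : ℕ := Fintype.card C.W

open scoped Classical in
/-- `val v` is, for every gate `v`, the polynomial that `v` computes: a wire passes on the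
polynomial of its tail, multiplied by the label of the wire. -/
def IsValuation (C : Circuit F X) (val : C.V → MvPolynomial X F) : Prop :=
  ∀ v, val v = match C.label v with
    | .const c => MvPolynomial.C c
    | .var x => MvPolynomial.X x
    | .add => ∑ w : C.W with C.tgt w = v, MvPolynomial.C (C.scalar w) * val (C.src w)
    | .mul => ∏ w : C.W with C.tgt w = v, MvPolynomial.C (C.scalar w) * val (C.src w)

theorem wellFounded {K Y : Type*} (C : Circuit K Y) :
    WellFounded (fun a b => ∃ w, C.src w = a ∧ C.tgt w = b) := by
  have : Std.Irrefl (Relation.TransGen (fun a b => ∃ w, C.src w = a ∧ C.tgt w = b)) :=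
    ⟨C.acyclic⟩
  exact Subrelation.wf (fun h => Relation.TransGen.single h)
    (Finite.wellFounded_of_trans_of_irrefl
      (Relation.TransGen (fun a b => ∃ w, C.src w = a ∧ C.tgt w = b)))

/-- Every circuit has exactly one valuation, so that each gate computes one polynomial. -/
theorem existsUnique_isValuation (C : Circuit F X) : ∃! val, C.IsValuation val := by
  classical
  have hu : ∀ f g, C.IsValuation f → C.IsValuation g → f = g := by
    intro f g hf hg
    funext v
    induction v using C.wellFounded.induction with
    | _ v ih =>
      have key : ∀ w ∈ Finset.univ.filter (fun w : C.W => C.tgt w = v),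
          MvPolynomial.C (C.scalar w) * f (C.src w) =
            MvPolynomial.C (C.scalar w) * g (C.src w) := by
        intro w hw
        rw [ih (C.src w) ⟨w, rfl, by simpa using hw⟩]
      rw [hf v, hg v]
      cases C.label v with
      | const c => rfl
      | var x => rfl
      | add => exact Finset.sum_congr (by ext; simp) fun w hw => key w (by simpa using hw)
      | mul => exact Finset.prod_congr (by ext; simp) fun w hw => key w (by simpa using hw)
  let step : ∀ v, (∀ u, (∃ w, C.src w = u ∧ C.tgt w = v) → MvPolynomial X F) →
      MvPolynomial X F := fun v rec => match C.label v with
    | .const c => MvPolynomial.C c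
    | .var x => MvPolynomial.X x
    | .add => ∑ w : C.W, if h : C.tgt w = v then
        MvPolynomial.C (C.scalar w) * rec (C.src w) ⟨w, rfl, h⟩ else 0
    | .mul => ∏ w : C.W, if h : C.tgt w = v then
        MvPolynomial.C (C.scalar w) * rec (C.src w) ⟨w, rfl, h⟩ else 1
  refine ⟨C.wellFounded.fix step, fun v => ?_, fun g hg => hu _ _ hg fun v => ?_⟩
  all_goals
    rw [C.wellFounded.fix_eq step v]
    simp only [step]
    cases C.label v with
    | const c => rfl
    | var x => rfl
    | add => simp [Finset.sum_filter]
    | mul => simp [Finset.prod_filter]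

/-- The circuit computes `f` if the polynomial of one of its outputs (its sinks) is `f`. -/
def Computes (C : Circuit F X) (f : MvPolynomial X F) : Prop :=
  ∃ val, C.IsValuation val ∧ ∃ o, (∀ w, C.src w ≠ o) ∧ val o = f

end Circuit

/-- The arithmetic circuit complexity of a tensor: the size of a smallest circuit computing it. -/
def Tensor.CC {ι : Fin d → Type} [∀ j, Fintype (ι j)] (T : Tensor F ι) : ℕ∞ :=
  ⨅ (C : Circuit F (Σ j, ι j)) (_ : C.Computes T.toPoly), (C.size : ℕ∞)

/-- Submultiplicativity of circuit complexity on `d`-mode tensors over `F`: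
`CC (T ⊗ U) ≤ CC T * CC U` for all `n` and all `T`, `U` in `(F ^ n) ^ {⊗ d}`. -/
def CCSubmultiplicative (F : Type*) [Field F] (d : ℕ) : Prop :=
  ∀ (n : ℕ) (T U : Tensor F (fun _ : Fin d => Fin n)), (T.kron U).CC ≤ T.CC * U.CC

/-! ### Matrix multiplication -/

/-- The `n × n` matrix multiplication tensor `∑ i j k, x_{i j} * y_{j k} * z_{k i}`. -/
def matMul (F : Type*) [Field F] (n : ℕ) : Tensor F (fun _ : Fin 3 => Fin n × Fin n) :=
  fun p => if (p 0).2 = (p 1).1 ∧ (p 1).2 = (p 2).1 ∧ (p 2).2 = (p 0).1 then 1 else 0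

/-- The exponent `ω` of square matrix multiplication over `F`: the infimum of all `β` such that
the rank of the `n × n` matrix multiplication tensor is `O(n ^ β)`. -/
def omega (F : Type*) [Field F] : ℝ :=
  sInf {β : ℝ | (fun n : ℕ => ((matMul F n).rank : ℝ)) =O[Filter.atTop]
    (fun n : ℕ => (n : ℝ) ^ β)}

end TensorComplexity

end

noncomputable section

namespace TensorComplexity

/-- The sums `∑ w, ℓ w * (a w * b w)` with all `ℓ w` in `L`. -/
def productSums {F A κ : Type*} [Field F] [CommRing A] [Algebra F A] [Fintype κ]
    (L : Submodule F A) (a b : κ → A) : Submodule F A where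
  carrier := {x | ∃ l : κ → A, (∀ w, l w ∈ L) ∧ x = ∑ w, l w * (a w * b w)}
  add_mem' := by
    rintro _ _ ⟨l, hl, rfl⟩ ⟨m, hm, rfl⟩
    exact ⟨fun w => l w + m w, fun w => L.add_mem (hl w) (hm w), by
      simp only [add_mul, Finset.sum_add_distrib]⟩
  zero_mem' := ⟨fun _ => 0, fun _ => L.zero_mem, by simp⟩
  smul_mem' := by
    rintro c _ ⟨l, hl, rfl⟩
    exact ⟨fun w => c • l w, fun w => L.smul_mem c (hl w), by
      simp only [smul_mul_assoc, Finset.smul_sum]⟩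

theorem mul_mem_productSums {F A κ : Type*} [Field F] [CommRing A] [Algebra F A] [Fintype κ]
    {L : Submodule F A} {a b : κ → A} {l : A} (hl : l ∈ L) (w : κ) :
    l * (a w * b w) ∈ productSums L a b := by
  classical
  refine ⟨fun v => if v = w then l else 0, fun v => ?_, ?_⟩
  · dsimp only
    split_ifs
    exacts [hl, L.zero_mem]
  · simp [ite_mul]

/-- The constant term of `p` is a scalar, the linear one is in `L`, the cubic one, and every
product of an element of `L` with the quadratic one, is in `W`. -/
structure LowCoeffs {F A : Type*} [Field F] [CommRing A] [Algebra F A] (L W : Submodule F A)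
    (p : Polynomial A) : Prop where
  coeff_zero : ∃ c : F, p.coeff 0 = algebraMap F A c
  coeff_one : p.coeff 1 ∈ L
  coeff_two : ∀ l ∈ L, l * p.coeff 2 ∈ W
  coeff_three : p.coeff 3 ∈ W

namespace LowCoeffs

variable {F A : Type*} [Field F] [CommRing A] [Algebra F A] {L W : Submodule F A}
  {p q : Polynomial A}

theorem of_natDegree_le_one (h0 : ∃ c : F, p.coeff 0 = algebraMap F A c) (h1 : p.coeff 1 ∈ L)
    (h : p.natDegree ≤ 1) : LowCoeffs L W p := by
  refine ⟨h0, h1, fun l _ => ?_, ?_⟩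
  · rw [Polynomial.coeff_eq_zero_of_natDegree_lt (by omega), mul_zero]
    exact W.zero_mem
  · rw [Polynomial.coeff_eq_zero_of_natDegree_lt (by omega)]
    exact W.zero_mem

theorem const (c : F) : LowCoeffs L W (Polynomial.C (algebraMap F A c)) :=
  of_natDegree_le_one ⟨c, by simp⟩ (by simp) (by simp)

theorem add (hp : LowCoeffs L W p) (hq : LowCoeffs L W q) : LowCoeffs L W (p + q) := by
  obtain ⟨⟨c, hc⟩, h1, h2, h3⟩ := hp
  obtain ⟨⟨c', hc'⟩, h1', h2', h3'⟩ := hq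
  refine ⟨⟨c + c', by simp [hc, hc']⟩, ?_, fun l hl => ?_, ?_⟩
  · simpa using L.add_mem h1 h1'
  · simpa [mul_add] using W.add_mem (h2 l hl) (h2' l hl)
  · simpa using W.add_mem h3 h3'

theorem mul (hp : LowCoeffs L W p) (hq : LowCoeffs L W q)
    (h : ∀ l ∈ L, l * (p.coeff 1 * q.coeff 1) ∈ W) : LowCoeffs L W (p * q) := by
  obtain ⟨⟨c, hc⟩, h1, h2, h3⟩ := hp
  obtain ⟨⟨c', hc'⟩, h1', h2', h3'⟩ := hq
  have e1 : (p * q).coeff 1 = c • q.coeff 1 + c' • p.coeff 1 := by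
    simp only [Polynomial.coeff_mul, Finset.Nat.antidiagonal_succ, Finset.Nat.antidiagonal_zero,
      Algebra.smul_def]
    simp [hc, hc']
    ring
  have e2 : (p * q).coeff 2 = c • q.coeff 2 + p.coeff 1 * q.coeff 1 + c' • p.coeff 2 := by
    simp only [Polynomial.coeff_mul, Finset.Nat.antidiagonal_succ, Finset.Nat.antidiagonal_zero,
      Algebra.smul_def]
    simp [hc, hc']
    ring
  have e3 : (p * q).coeff 3 =
      c • q.coeff 3 + p.coeff 1 * q.coeff 2 + q.coeff 1 * p.coeff 2 + c' • p.coeff 3 := by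
    simp only [Polynomial.coeff_mul, Finset.Nat.antidiagonal_succ, Finset.Nat.antidiagonal_zero,
      Algebra.smul_def]
    simp [hc, hc']
    ring
  refine ⟨⟨c * c', by simp [Polynomial.mul_coeff_zero, hc, hc']⟩, ?_, fun l hl => ?_, ?_⟩
  · rw [e1]
    exact L.add_mem (L.smul_mem _ h1') (L.smul_mem _ h1)
  · rw [e2, mul_add, mul_add, mul_smul_comm, mul_smul_comm]
    exact W.add_mem (W.add_mem (W.smul_mem _ (h2' l hl)) (h l hl)) (W.smul_mem _ (h2 l hl))
  · rw [e3]
    exact W.add_mem (W.add_mem (W.add_mem (W.smul_mem _ h3') (h2' _ h1)) (h2 _ h1'))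
      (W.smul_mem _ h3)

theorem const_mul (c : F) (hp : LowCoeffs L W p) :
    LowCoeffs L W (Polynomial.C (algebraMap F A c) * p) :=
  (const c).mul hp fun l _ => by simp

theorem sum {κ : Type*} (s : Finset κ) {f : κ → Polynomial A}
    (h : ∀ w ∈ s, LowCoeffs L W (f w)) : LowCoeffs L W (∑ w ∈ s, f w) := by
  classical
  induction s using Finset.induction_on with
  | empty => simpa using const (L := L) (W := W) (0 : F)
  | insert w s hw ih =>
    rw [Finset.sum_insert hw]
    exact (h w (by simp)).add (ih fun v hv => h v (by simp [hv]))

theorem prod {κ : Type*} [LinearOrder κ] (s : Finset κ) {f : κ → Polynomial A}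
    (h : ∀ w ∈ s, LowCoeffs L W (f w))
    (hW : ∀ w ∈ s, ∀ l ∈ L, l * ((f w).coeff 1 * (∏ v ∈ s with v < w, f v).coeff 1) ∈ W) :
    LowCoeffs L W (∏ w ∈ s, f w) := by
  induction s using Finset.induction_on_max with
  | empty => simpa using const (L := L) (W := W) (1 : F)
  | insert w s hw ih =>
    have hws : w ∉ s := fun hm => lt_irrefl _ (hw w hm)
    rw [Finset.prod_insert hws]
    refine (h w (by simp)).mul (ih (fun v hv => h v (by simp [hv])) fun v hv l hl => ?_)
      fun l hl => ?_
    · have := hW v (by simp [hv]) l hl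
      rwa [Finset.filter_insert, if_neg (hw v hv).asymm] at this
    · have := hW w (by simp) l hl
      rwa [Finset.filter_insert, if_neg (lt_irrefl w), Finset.filter_true_of_mem hw] at this

end LowCoeffs

/-- If all variables are replaced by affine expressions in `t`, the coefficient of `t ^ 3` of a
polynomial computed by a circuit is a sum of products of three linear terms, one per wire. -/
theorem Circuit.exists_coeff_three_eq_sum {F X A : Type*} [Field F] [CommRing A] [Algebra F A]
    (C : Circuit F X) {f : MvPolynomial X F} (hf : C.Computes f)
    (φ : MvPolynomial X F →ₐ[F] Polynomial A) (L : Submodule F A)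
    (h0 : ∀ x, ∃ c : F, (φ (MvPolynomial.X x)).coeff 0 = algebraMap F A c)
    (h1 : ∀ x, (φ (MvPolynomial.X x)).coeff 1 ∈ L)
    (hd : ∀ x, (φ (MvPolynomial.X x)).natDegree ≤ 1) :
    ∃ l a b : C.W → A, (∀ w, l w ∈ L) ∧ (∀ w, a w ∈ L) ∧ (∀ w, b w ∈ L) ∧
      (φ f).coeff 3 = ∑ w, l w * (a w * b w) := by
  classical
  obtain ⟨val, hval, o, -, rfl⟩ := hf
  let _ : LinearOrder C.W := LinearOrder.lift' (Fintype.equivFin C.W) (Equiv.injective _)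
  let g : C.W → Polynomial A := fun w => φ (MvPolynomial.C (C.scalar w) * val (C.src w))
  let a : C.W → A := fun w => (g w).coeff 1
  let b : C.W → A := fun w =>
    (∏ v ∈ Finset.univ.filter (fun v => C.tgt v = C.tgt w) with v < w, g v).coeff 1
  have hC : ∀ c : F, φ (MvPolynomial.C c) = Polynomial.C (algebraMap F A c) := fun c =>
    φ.commutes c
  have key : ∀ v, LowCoeffs L (productSums L a b) (φ (val v)) := by
    intro v
    induction v using C.wellFounded.induction with
    | _ v ih =>
      have hg : ∀ w, C.tgt w = v → LowCoeffs L (productSums L a b) (g w) := by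
        intro w hw
        simp only [g, map_mul, hC]
        exact (ih (C.src w) ⟨w, rfl, hw⟩).const_mul _
      have hv := hval v
      cases hl : C.label v with
      | const c =>
        simp only [hl] at hv
        rw [hv, hC]
        exact LowCoeffs.const c
      | var x =>
        simp only [hl] at hv
        rw [hv]
        exact LowCoeffs.of_natDegree_le_one (h0 x) (h1 x) (hd x)
      | add =>
        simp only [hl] at hv
        rw [hv, map_sum]
        exact LowCoeffs.sum _ fun w hw => hg w (by simpa using hw)
      | mul =>
        simp only [hl] at hv
        rw [hv, map_prod]
        have := LowCoeffs.prod (Finset.univ.filter fun w => C.tgt w = v)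
          (fun w hw => hg w (by simpa using hw)) (fun w hw l hl => by
            have hw' : C.tgt w = v := by simpa using hw
            have := mul_mem_productSums (a := a) (b := b) hl w
            simpa only [a, b, hw'] using this)
        convert this using 2
  obtain ⟨l, hl, h⟩ := (key o).coeff_three
  refine ⟨l, a, b, hl, fun w => ?_, fun w => ?_, h⟩
  · have := ((key (C.src w)).const_mul (C.scalar w)).coeff_one
    simpa only [a, g, map_mul, hC] using this
  · have : LowCoeffs L ⊤ (∏ v ∈ Finset.univ.filter (fun v => C.tgt v = C.tgt w) with v < w, g v) :=
      LowCoeffs.prod _ (fun v _ => by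
        have := (key (C.src v)).const_mul (C.scalar v)
        simp only [g, map_mul, hC]
        exact ⟨this.coeff_zero, this.coeff_one, fun _ _ => trivial, trivial⟩)
        fun _ _ _ _ => trivial
    exact this.coeff_one

/-- Renaming the variables of a circuit. -/
def Circuit.rename {F X Y : Type*} [Field F] (C : Circuit F X) (f : X → Y) : Circuit F Y where
  V := C.V
  W := C.W
  src := C.src
  tgt := C.tgt
  label v := match C.label v with
    | .const c => .const c
    | .var x => .var (f x)
    | .add => .add
    | .mul => .mul
  scalar := C.scalar
  acyclic := C.acyclic
  input_iff_source v := by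
    rw [← C.input_iff_source v]
    cases C.label v <;> rfl

theorem Circuit.Computes.rename {F X Y : Type*} [Field F] {C : Circuit F X}
    {p : MvPolynomial X F} (h : C.Computes p) (f : X → Y) :
    (C.rename f).Computes (MvPolynomial.rename f p) := by
  classical
  obtain ⟨val, hval, o, ho, rfl⟩ := h
  refine ⟨fun v => MvPolynomial.rename f (val v), fun v => ?_, o, ho, rfl⟩
  have hv := hval v
  simp only [Circuit.rename]
  rw [hv]
  cases C.label v with
  | const c => simp
  | var x => simp
  | add => simp only [map_sum, map_mul, MvPolynomial.rename_C]; congr!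
  | mul => simp only [map_prod, map_mul, MvPolynomial.rename_C]; congr!

theorem Tensor.CC_le_of_computes {F : Type*} [Field F] {d : ℕ} {ι : Fin d → Type}
    [∀ j, Fintype (ι j)] {T : Tensor F ι} (C : Circuit F (Σ j, ι j)) (h : C.Computes T.toPoly) :
    T.CC ≤ C.size :=
  iInf₂_le C h

theorem Tensor.exists_circuit_of_CC_le {F : Type*} [Field F] {d : ℕ} {ι : Fin d → Type}
    [∀ j, Fintype (ι j)] {T : Tensor F ι} {s : ℕ} (h : T.CC ≤ s) :
    ∃ C : Circuit F (Σ j, ι j), C.Computes T.toPoly ∧ C.size ≤ s := by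
  have h' : T.CC < ((s + 1 : ℕ) : ℕ∞) := h.trans_lt (by exact_mod_cast Nat.lt_succ_self s)
  simp only [Tensor.CC, iInf_lt_iff] at h'
  obtain ⟨C, hC, hs⟩ := h'
  exact ⟨C, hC, Nat.lt_succ_iff.mp (by exact_mod_cast hs)⟩

/-- Extension by zero along an embedding of the index sets of all modes. -/
def Tensor.extend {F : Type*} [Field F] {d : ℕ} {ι κ : Type} (e : ι ↪ κ)
    (T : Tensor F (fun _ : Fin d => ι)) : Tensor F (fun _ : Fin d => κ) :=
  Function.extend (fun (p : Fin d → ι) j => e (p j)) T 0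

theorem comp_embedding_injective {d : ℕ} {ι κ : Type} (e : ι ↪ κ) :
    Function.Injective (fun (p : Fin d → ι) j => e (p j)) :=
  fun _ _ h => funext fun j => e.injective (congrFun h j)

theorem Tensor.extend_apply {F : Type*} [Field F] {d : ℕ} {ι κ : Type} (e : ι ↪ κ)
    (T : Tensor F (fun _ : Fin d => ι)) (p : Fin d → ι) :
    T.extend e (fun j => e (p j)) = T p :=
  (comp_embedding_injective e).extend_apply T 0 p

theorem Tensor.toPoly_extend {F : Type*} [Field F] {d : ℕ} {ι κ : Type} [Fintype ι] [Fintype κ]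
    (e : ι ↪ κ) (T : Tensor F (fun _ : Fin d => ι)) :
    (T.extend e).toPoly = MvPolynomial.rename (Sigma.map id fun _ => e) T.toPoly := by
  symm
  simp only [Tensor.toPoly, map_sum, map_mul, map_prod, MvPolynomial.rename_C,
    MvPolynomial.rename_X]
  refine Fintype.sum_of_injective (fun (p : Fin d → ι) j => e (p j))
    (comp_embedding_injective e) _ _ (fun p hp => ?_) fun p => ?_
  · have : T.extend e p = 0 := Function.extend_apply' _ _ _ fun ⟨q, hq⟩ => hp ⟨q, hq⟩
    simp [this]
  · rw [Tensor.extend_apply]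
    rfl

theorem Tensor.CC_extend_le {F : Type*} [Field F] {d : ℕ} {ι κ : Type} [Fintype ι] [Fintype κ]
    (e : ι ↪ κ) (T : Tensor F (fun _ : Fin d => ι)) : (T.extend e).CC ≤ T.CC := by
  refine le_iInf₂ fun C hC => ?_
  refine Tensor.CC_le_of_computes (C.rename (Sigma.map id fun _ => e)) ?_
  rw [Tensor.toPoly_extend]
  exact hC.rename _

/-- The product `(∑ t, x_t * y_t) * (∑ s, z_s * w_s)`, where the modes of `x`, `y` and those of
`z`, `w` are the pairs `e (false, ·)` and `e (true, ·)`. -/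
def pairing (F : Type*) [Field F] (ι : Type) [DecidableEq ι] (e : Bool × Bool ≃ Fin 4) :
    Tensor F (fun _ : Fin 4 => ι) :=
  fun p => if ∀ b, p (e (b, false)) = p (e (b, true)) then 1 else 0

theorem toPoly_pairing (F : Type*) [Field F] (ι : Type) [DecidableEq ι] [Fintype ι]
    (e : Bool × Bool ≃ Fin 4) :
    (pairing F ι e).toPoly =
      ∏ b : Bool, ∑ t : ι, ∏ c : Bool, MvPolynomial.X ⟨e (b, c), t⟩ := by
  rw [Fintype.prod_sum]
  symm
  refine Fintype.sum_of_injective (fun (q : Bool → ι) (j : Fin 4) => q (e.symm j).1)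
    (fun q q' h => funext fun b => ?_) _ _ (fun p hp => ?_) fun q => ?_
  · simpa using congrFun h (e (b, false))
  · have : pairing F ι e p = 0 := by
      refine if_neg fun h => hp ⟨fun b => p (e (b, false)), funext fun j => ?_⟩
      obtain ⟨⟨b, c⟩, rfl⟩ := e.surjective j
      cases c
      · simp
      · simp [h b]
    simp [this]
  · have : pairing F ι e (fun j => q (e.symm j).1) = 1 := if_pos fun b => by simp
    rw [this, ← Equiv.prod_comp e, Fintype.prod_prod_type]
    simp

/-- A circuit for `pairing F ι e`. -/
def pairingCircuit (F : Type*) [Field F] (ι : Type) [Fintype ι] [Nonempty ι]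
    (e : Bool × Bool ≃ Fin 4) : Circuit F (Σ _ : Fin 4, ι) where
  V := ((Bool × Bool) × ι) ⊕ (Bool × ι) ⊕ Bool ⊕ Unit
  W := ((Bool × Bool) × ι) ⊕ (Bool × ι) ⊕ Bool
  src := Sum.map id (Sum.map id Sum.inl)
  tgt := Sum.elim (fun x => .inr (.inl (x.1.1, x.2)))
    (Sum.elim (fun x => .inr (.inr (.inl x.1))) fun _ => .inr (.inr (.inr ())))
  label := Sum.elim (fun x => .var ⟨e x.1, x.2⟩)
    (Sum.elim (fun _ => .mul) (Sum.elim (fun _ => .add) fun _ => .mul))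
  scalar _ := 1
  acyclic := by
    let rk : ((Bool × Bool) × ι) ⊕ (Bool × ι) ⊕ Bool ⊕ Unit → ℕ :=
      Sum.elim (fun _ => 0) (Sum.elim (fun _ => 1) (Sum.elim (fun _ => 2) fun _ => 3))
    intro v hv
    have : ∀ u v, Relation.TransGen (fun a b =>
        ∃ w : ((Bool × Bool) × ι) ⊕ (Bool × ι) ⊕ Bool, Sum.map id (Sum.map id Sum.inl) w = a ∧
          Sum.elim (fun x => .inr (.inl (x.1.1, x.2))) (Sum.elim (fun x => .inr (.inr (.inl x.1)))
            fun _ => .inr (.inr (.inr ()))) w = b) u v → rk u < rk v := by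
      intro u v h
      induction h with
      | single h =>
        obtain ⟨w, rfl, rfl⟩ := h
        rcases w with w | w | w <;> simp [rk]
      | tail _ h ih =>
        obtain ⟨w, rfl, rfl⟩ := h
        refine ih.trans ?_
        rcases w with w | w | w <;> simp [rk]
    exact lt_irrefl _ (this v v hv)
  input_iff_source := by
    have t : ι := Classical.arbitrary ι
    rintro (⟨x, s⟩ | ⟨b, s⟩ | b | u)
    · simp [Label.IsInput]
    · simp only [Sum.elim_inr, Sum.elim_inl, Label.IsInput, false_iff, not_forall, not_not]
      exact ⟨.inl ((b, false), s), rfl⟩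
    · simp only [Sum.elim_inr, Sum.elim_inl, Label.IsInput, false_iff, not_forall, not_not]
      exact ⟨.inr (.inl (b, t)), rfl⟩
    · simp only [Sum.elim_inr, Label.IsInput, false_iff, not_forall, not_not]
      exact ⟨.inr (.inr false), rfl⟩

@[to_additive]
theorem prod_filter_eq_of_range {κ W M : Type*} [Fintype κ] [Fintype W] [CommMonoid M]
    {P : W → Prop} [DecidablePred P] (i : κ → W) (hi : Function.Injective i)
    (h : ∀ w, P w ↔ ∃ k, i k = w) (f : W → M) : ∏ w with P w, f w = ∏ k, f (i k) := by
  refine (Finset.prod_nbij i (fun k _ => ?_) hi.injOn (fun w hw => ?_) fun _ _ => rfl).symm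
  · simp [h]
  · simpa [h] using hw

theorem pairingCircuit_computes (F : Type*) [Field F] (ι : Type) [Fintype ι] [Nonempty ι]
    (e : Bool × Bool ≃ Fin 4) :
    (pairingCircuit F ι e).Computes
      (∏ b : Bool, ∑ t : ι, ∏ c : Bool, MvPolynomial.X ⟨e (b, c), t⟩) := by
  classical
  let val : ((Bool × Bool) × ι) ⊕ (Bool × ι) ⊕ Bool ⊕ Unit → MvPolynomial (Σ _ : Fin 4, ι) F :=
    Sum.elim (fun x => MvPolynomial.X ⟨e x.1, x.2⟩)
      (Sum.elim (fun x => ∏ c : Bool, MvPolynomial.X ⟨e (x.1, c), x.2⟩)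
        (Sum.elim (fun b => ∑ t : ι, ∏ c : Bool, MvPolynomial.X ⟨e (b, c), t⟩)
          fun _ => ∏ b : Bool, ∑ t : ι, ∏ c : Bool, MvPolynomial.X ⟨e (b, c), t⟩))
  refine ⟨val, ?_, .inr (.inr (.inr ())), ?_, rfl⟩
  · rintro (⟨x, s⟩ | ⟨b, s⟩ | b | u)
    · rfl
    · refine Eq.trans ?_ (prod_filter_eq_of_range (fun c => .inl ((b, c), s))
        (fun _ _ h => by cases h; rfl) (fun w => ?_) _).symm
      · simp [val, pairingCircuit]
      · rcases w with ⟨⟨b', c⟩, t⟩ | w | w <;> simp [pairingCircuit, eq_comm]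
    · refine Eq.trans ?_ (sum_filter_eq_of_range (fun t => .inr (.inl (b, t)))
        (fun _ _ h => by cases h; rfl) (fun w => ?_) _).symm
      · simp [val, pairingCircuit]
      · rcases w with w | ⟨b', t⟩ | w <;> simp [pairingCircuit, eq_comm]
    · refine Eq.trans ?_ (prod_filter_eq_of_range (fun b => .inr (.inr b))
        (fun _ _ h => by cases h; rfl) (fun w => ?_) _).symm
      · simp [val, pairingCircuit]
      · rcases w with w | w | b <;> simp [pairingCircuit]
  · rintro (w | w | w) <;> simp [pairingCircuit]

theorem CC_pairing_le (F : Type*) [Field F] (ι : Type) [DecidableEq ι] [Fintype ι] [Nonempty ι]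
    (e : Bool × Bool ≃ Fin 4) :
    (pairing F ι e).CC ≤ ((6 * Fintype.card ι + 2 : ℕ) : ℕ∞) := by
  have h : (pairingCircuit F ι e).Computes (pairing F ι e).toPoly := by
    rw [toPoly_pairing]
    exact pairingCircuit_computes F ι e
  refine (Tensor.CC_le_of_computes _ h).trans ?_
  have : (pairingCircuit F ι e).size = 6 * Fintype.card ι + 2 := by
    change Fintype.card (((Bool × Bool) × ι) ⊕ (Bool × ι) ⊕ Bool) = _
    simp
    ring
  rw [this]

/-- The direct sum, indexed by `I`, of matrix multiplication tensors with matrices indexed by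
`M × M` is a sum of `r` products of three linear forms. -/
def MatMulSumRankLE (F : Type*) [Field F] (I M : Type*) (r : ℕ) : Prop :=
  ∃ α β γ : Fin r → I → M → M → F, ∀ i j k a b c d e g,
    (i = j ∧ j = k ∧ b = c ∧ d = e ∧ g = a → ∑ t, α t i a b * β t j c d * γ t k e g = 1) ∧
    (¬ (i = j ∧ j = k ∧ b = c ∧ d = e ∧ g = a) → ∑ t, α t i a b * β t j c d * γ t k e g = 0)

open scoped Classical in
theorem matMulSumRankLE_iff (F : Type*) [Field F] (I M : Type*) (r : ℕ) :
    MatMulSumRankLE F I M r ↔ ∃ α β γ : Fin r → I → M → M → F, ∀ i j k a b c d e g,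
      ∑ t, α t i a b * β t j c d * γ t k e g =
        if i = j ∧ j = k ∧ b = c ∧ d = e ∧ g = a then 1 else 0 := by
  refine exists_congr fun α => exists_congr fun β => exists_congr fun γ => ?_
  refine ⟨fun h i j k a b c d e g => ?_, fun h i j k a b c d e g => ⟨fun h' => ?_, fun h' => ?_⟩⟩
  · split_ifs with h'
    exacts [(h i j k a b c d e g).1 h', (h i j k a b c d e g).2 h']
  · rw [h, if_pos h']
  · rw [h, if_neg h']

namespace MatMulSumRankLE

variable {F : Type*} [Field F] {I J M N : Type*}

theorem of_fintype {κ : Type*} [Fintype κ] {r : ℕ} (hr : Fintype.card κ ≤ r)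
    (α β γ : κ → I → M → M → F)
    (h : ∀ i j k a b c d e g,
      (i = j ∧ j = k ∧ b = c ∧ d = e ∧ g = a → ∑ t, α t i a b * β t j c d * γ t k e g = 1) ∧
      (¬ (i = j ∧ j = k ∧ b = c ∧ d = e ∧ g = a) →
        ∑ t, α t i a b * β t j c d * γ t k e g = 0)) :
    MatMulSumRankLE F I M r := by
  obtain ⟨f⟩ : Nonempty (κ ↪ Fin r) := Function.Embedding.nonempty_of_card_le (by simpa using hr)
  refine ⟨Function.extend f α 0, Function.extend f β 0, Function.extend f γ 0,
    fun i j k a b c d e g => ?_⟩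
  rw [← Fintype.sum_of_injective f f.injective
    (fun t => α t i a b * β t j c d * γ t k e g) _ (fun t ht => ?_) fun t => ?_]
  · exact h i j k a b c d e g
  · rw [Function.extend_apply' _ _ _ (by simpa using ht)]
    simp
  · simp [f.injective.extend_apply]

theorem comap {r : ℕ} (h : MatMulSumRankLE F J N r) (f : I ↪ J) (m : M ↪ N) :
    MatMulSumRankLE F I M r := by
  obtain ⟨α, β, γ, h⟩ := h
  refine ⟨fun t i a b => α t (f i) (m a) (m b), fun t i a b => β t (f i) (m a) (m b),
    fun t i a b => γ t (f i) (m a) (m b), fun i j k a b c d e g => ?_⟩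
  simpa using h (f i) (f j) (f k) (m a) (m b) (m c) (m d) (m e) (m g)

/-- Copies of a direct sum. -/
theorem prod_copies {r : ℕ} (h : MatMulSumRankLE F I M r) (q : ℕ) :
    MatMulSumRankLE F (I × Fin q) M (r * q) := by
  classical
  rw [matMulSumRankLE_iff] at h
  obtain ⟨α, β, γ, h⟩ := h
  refine of_fintype (κ := Fin r × Fin q) (by simp)
    (fun t i a b => if i.2 = t.2 then α t.1 i.1 a b else 0)
    (fun t i a b => if i.2 = t.2 then β t.1 i.1 a b else 0)
    (fun t i a b => if i.2 = t.2 then γ t.1 i.1 a b else 0) ?_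
  rintro ⟨i, i'⟩ ⟨j, j'⟩ ⟨k, k'⟩ a b c d e g
  have key : ∑ t : Fin r × Fin q, (if i' = t.2 then α t.1 i a b else 0) *
      (if j' = t.2 then β t.1 j c d else 0) * (if k' = t.2 then γ t.1 k e g else 0) =
      if i' = j' ∧ j' = k' then (∑ t, α t i a b * β t j c d * γ t k e g) else 0 := by
    rw [Fintype.sum_prod_type]
    simp only [ite_mul, zero_mul, Finset.sum_ite_eq, Finset.mem_univ, if_true]
    by_cases h1 : i' = j'
    · subst h1
      by_cases h2 : i' = k'
      · subst h2
        simp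
      · simp [h2, Ne.symm h2]
    · simp [h1, Ne.symm h1]
  simp only [key, h, Prod.mk.injEq]
  constructor
  · rintro ⟨⟨rfl, rfl⟩, ⟨rfl, rfl⟩, rfl, rfl, rfl⟩
    simp
  · intro h'
    rw [← ite_and, if_neg]
    tauto

/-- If `r` products give the direct sum indexed by `I`, then each of them can be replaced by a
matrix multiplication tensor. -/
theorem comp {r s : ℕ} (h : MatMulSumRankLE F I M r) (h' : MatMulSumRankLE F (Fin r) N s) :
    MatMulSumRankLE F I (M × N) s := by
  classical
  rw [matMulSumRankLE_iff] at h h' ⊢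
  obtain ⟨α, β, γ, h⟩ := h
  obtain ⟨α', β', γ', h'⟩ := h'
  refine ⟨fun u i a b => ∑ t, α t i a.1 b.1 * α' u t a.2 b.2,
    fun u i a b => ∑ t, β t i a.1 b.1 * β' u t a.2 b.2,
    fun u i a b => ∑ t, γ t i a.1 b.1 * γ' u t a.2 b.2, ?_⟩
  rintro i j k ⟨a, a'⟩ ⟨b, b'⟩ ⟨c, c'⟩ ⟨d, d'⟩ ⟨e, e'⟩ ⟨g, g'⟩
  calc _ = ∑ t₁, ∑ t₂, ∑ t₃, (α t₁ i a b * β t₂ j c d * γ t₃ k e g) *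
        ∑ u, α' u t₁ a' b' * β' u t₂ c' d' * γ' u t₃ e' g' := by
        have hd : ∀ x y z : Fin r → F, (∑ t, x t) * (∑ t, y t) * (∑ t, z t) =
            ∑ t₁, ∑ t₂, ∑ t₃, x t₁ * (y t₂ * z t₃) := fun x y z => by
          rw [mul_assoc, Finset.sum_mul_sum, Finset.sum_mul]
          simp only [Finset.mul_sum]
        simp only [hd]
        rw [Finset.sum_comm]
        refine Finset.sum_congr rfl fun t₁ _ => ?_
        rw [Finset.sum_comm]
        refine Finset.sum_congr rfl fun t₂ _ => ?_
        rw [Finset.sum_comm]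
        refine Finset.sum_congr rfl fun t₃ _ => ?_
        rw [Finset.mul_sum]
        exact Finset.sum_congr rfl fun u _ => by ring
    _ = (∑ t, α t i a b * β t j c d * γ t k e g) *
        if b' = c' ∧ d' = e' ∧ g' = a' then 1 else 0 := by
        simp only [h', Finset.sum_mul]
        refine Finset.sum_congr rfl fun t _ => ?_
        rw [Finset.sum_eq_single t, Finset.sum_eq_single t]
        · simp
        · intro v _ hv
          simp [Ne.symm hv]
        · simp
        · intro v _ hv
          simp [Ne.symm hv]
        · simp
    _ = _ := by
        rw [h, ite_zero_mul_ite_zero, mul_one]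
        simp only [Prod.mk.injEq]
        split_ifs <;> first | rfl | (exfalso; tauto)

/-- A single entry per matrix. -/
theorem of_unique [Unique M] (n : ℕ) : MatMulSumRankLE F (Fin n) M n := by
  classical
  rw [matMulSumRankLE_iff]
  refine ⟨fun t i _ _ => if i = t then 1 else 0, fun t i _ _ => if i = t then 1 else 0,
    fun t i _ _ => if i = t then 1 else 0, fun i j k a b c d e g => ?_⟩
  simp only [ite_mul, one_mul, zero_mul, Finset.sum_ite_eq, Finset.mem_univ, if_true,
    Subsingleton.elim _ (default : M)]
  by_cases h1 : i = j
  · subst h1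
    simp [eq_comm]
  · simp [h1, Ne.symm h1]

/-- Recursive multiplication: the rank of `f` copies grows by the factor `q` when the matrices
grow by the factor `n`, if `f` copies of `n × n` multiplication have rank at most `f * q`. -/
theorem pow {f q n : ℕ} (h : MatMulSumRankLE F (Fin f) (Fin n) (f * q)) (s : ℕ) :
    MatMulSumRankLE F (Fin f) (Fin (n ^ s)) (f * q ^ s) := by
  induction s with
  | zero => simpa using of_unique (M := Fin 1) f
  | succ s ih =>
    have h1 := (ih.prod_copies q).comap
      (finProdFinEquiv (m := f) (n := q)).symm.toEmbedding (Function.Embedding.refl _)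
    have h2 := (h.comp h1).comap (Function.Embedding.refl _)
      ((finCongr (pow_succ' n s)).trans finProdFinEquiv.symm).toEmbedding
    rwa [mul_assoc, ← pow_succ] at h2

end MatMulSumRankLE

/-- Zero terms can be dropped from a decomposition. -/
theorem Tensor.rank_le_of_eq_sum {F : Type*} [Field F] {d : ℕ} {ι : Fin d → Type}
    {T : Tensor F ι} {r : ℕ} (l : Fin r → ∀ j, ι j → F)
    (h : ∀ p, T p = ∑ t, ∏ j, l t j (p j)) : T.rank ≤ r := by
  classical
  let S : Fin r → Tensor F ι := fun t p => ∏ j, l t j (p j)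
  let s : Finset (Fin r) := Finset.univ.filter fun t => S t ≠ 0
  have hs : s.card ≤ r := (Finset.card_le_univ s).trans (by simp)
  refine le_trans (Nat.sInf_le ?_) hs
  refine ⟨fun i => S (s.equivFin.symm i), fun i => ⟨?_, l (s.equivFin.symm i), fun p => rfl⟩, ?_⟩
  · exact (Finset.mem_filter.mp (s.equivFin.symm i).2).2
  · rw [Equiv.sum_comp s.equivFin.symm (fun t : s => S t), Finset.sum_coe_sort s S,
      Finset.sum_filter_ne_zero]
    funext p
    rw [h p, Finset.sum_apply]

theorem rank_matMul_le {F : Type*} [Field F] {f n r : ℕ} (hf : 0 < f)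
    (h : MatMulSumRankLE F (Fin f) (Fin n) r) : (matMul F n).rank ≤ r := by
  classical
  rw [matMulSumRankLE_iff] at h
  obtain ⟨α, β, γ, h⟩ := h
  let i : Fin f := ⟨0, hf⟩
  refine Tensor.rank_le_of_eq_sum
    (fun t => ![fun p => α t i p.1 p.2, fun p => β t i p.1 p.2, fun p => γ t i p.1 p.2])
    fun p => ?_
  simp only [Fin.prod_univ_three]
  simp [matMul, h]

theorem Tensor.exists_eq_sum_rank {F : Type*} [Field F] {d : ℕ} {ι : Fin d → Type}
    [∀ j, Fintype (ι j)] (T : Tensor F ι) (hd : 0 < d) :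
    ∃ l : Fin T.rank → ∀ j, ι j → F, ∀ p, T p = ∑ t, ∏ j, l t j (p j) := by
  classical
  have hne : {r : ℕ | ∃ S : Fin r → Tensor F ι, (∀ i, (S i).IsRankOne) ∧ T = ∑ i, S i}.Nonempty := by
    let s : Finset (∀ j, ι j) := Finset.univ.filter fun q => T q ≠ 0
    let S : (∀ j, ι j) → Tensor F ι := fun q => Pi.single q (T q)
    refine ⟨s.card, fun i => S (s.equivFin.symm i), fun i => ⟨?_, ?_⟩, ?_⟩
    · simpa [S] using (Finset.mem_filter.mp (s.equivFin.symm i).2).2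
    · dsimp only
      generalize (s.equivFin.symm i : ∀ j, ι j) = q
      refine ⟨fun j => if j = ⟨0, hd⟩ then Pi.single (q j) (T q) else Pi.single (q j) 1,
        fun p => ?_⟩
      by_cases hp : p = q
      · subst hp
        rw [Finset.prod_eq_single ⟨0, hd⟩] <;> simp +contextual [S]
      · obtain ⟨j, hj⟩ := Function.ne_iff.mp hp
        rw [Finset.prod_eq_zero (Finset.mem_univ j)]
        · simp [S, hp]
        · dsimp only
          split_ifs <;> simp [hj]
    · rw [Equiv.sum_comp s.equivFin.symm (fun t : s => S t), Finset.sum_coe_sort s S,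
        Finset.sum_filter_of_ne]
      · exact (Finset.univ_sum_single T).symm
      · intro q _ hq h0
        exact hq (by simp [S, h0])
  obtain ⟨S, hS, hT⟩ := Nat.sInf_mem hne
  choose l hl using fun i => (hS i).2
  refine ⟨l, fun p => ?_⟩
  conv_lhs => rw [hT]
  rw [Finset.sum_apply]
  exact Finset.sum_congr rfl fun i _ => hl i p

theorem sq_le_rank_matMul (F : Type*) [Field F] (n : ℕ) : n ^ 2 ≤ (matMul F n).rank := by
  classical
  obtain ⟨l, hl⟩ := (matMul F n).exists_eq_sum_rank (by norm_num)
  let φ : (Fin n × Fin n → F) →ₗ[F] (Fin (matMul F n).rank → F) :=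
    LinearMap.pi fun t => ∑ x, l t 0 x • LinearMap.proj x
  have hφ : Function.Injective φ := by
    rw [← LinearMap.ker_eq_bot, LinearMap.ker_eq_bot']
    rintro v hv
    funext ⟨i, j⟩
    have h0 : ∀ t, ∑ x, l t 0 x * v x = 0 := fun t => by
      simpa [φ] using congrFun hv t
    have h1 : ∑ x, v x * matMul F n ![x, (j, i), (i, i)] = 0 := by
      simp only [hl, Fin.prod_univ_three, Finset.mul_sum]
      rw [Finset.sum_comm]
      refine Finset.sum_eq_zero fun t _ => ?_
      calc _ = (∑ x, l t 0 x * v x) * (l t 1 (j, i) * l t 2 (i, i)) := by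
            rw [Finset.sum_mul]
            refine Finset.sum_congr rfl fun x _ => ?_
            simp
            ring
        _ = 0 := by rw [h0, zero_mul]
    rw [Finset.sum_eq_single (i, j)] at h1
    · simpa [matMul] using h1
    · rintro ⟨a, b⟩ - hab
      have : ¬ (b = j ∧ i = a) := fun h => hab (by simp [h.1, h.2])
      simp [matMul, this]
    · simp
  have := LinearMap.finrank_le_finrank_of_injective hφ
  simpa [sq] using this

open Filter Asymptotics in
theorem two_le_of_rank_isBigO (F : Type*) [Field F] {β : ℝ}
    (h : (fun n : ℕ => ((matMul F n).rank : ℝ)) =O[atTop] (fun n : ℕ => (n : ℝ) ^ β)) : 2 ≤ β := by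
  have h1 : (fun n : ℕ => (n : ℝ) ^ (2 : ℝ)) =O[atTop] (fun n : ℕ => (n : ℝ) ^ β) := by
    refine IsBigO.trans (IsBigO.of_bound 1 (Eventually.of_forall fun n => ?_)) h
    have := sq_le_rank_matMul F n
    rw [one_mul, Real.norm_of_nonneg (by positivity), Real.norm_of_nonneg (by positivity)]
    have h2 : ((n ^ 2 : ℕ) : ℝ) ≤ (matMul F n).rank := by exact_mod_cast this
    simpa using h2
  by_contra! hlt
  obtain ⟨c, hc⟩ := h1.bound
  have h2 : Tendsto (fun n : ℕ => (n : ℝ) ^ (2 - β)) atTop atTop :=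
    (tendsto_rpow_atTop (sub_pos.mpr hlt)).comp tendsto_natCast_atTop_atTop
  obtain ⟨n, ⟨hn, hn0⟩, hnc⟩ :=
    ((hc.and (eventually_gt_atTop 0)).and (h2.eventually_gt_atTop c)).exists
  have hn0' : (0 : ℝ) < n := by exact_mod_cast hn0
  rw [Real.norm_of_nonneg (by positivity), Real.norm_of_nonneg (by positivity)] at hn
  rw [Real.rpow_sub hn0', lt_div_iff₀ (by positivity)] at hnc
  exact absurd hn hnc.not_ge

open Filter Asymptotics in
/-- If `n` copies of `n × n` matrix multiplication cost `K * n ^ 2` each, the exponent is two. -/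
theorem omega_eq_two_of_rank_le (F : Type*) [Field F] (K : ℕ) (hK : 2 ≤ K)
    (h : ∀ n : ℕ, 0 < n → MatMulSumRankLE F (Fin n) (Fin n) (n * (K * n ^ 2))) :
    omega F = 2 := by
  have hmem : ∀ k : ℕ, 0 < k → (2 + 1 / k : ℝ) ∈ {β : ℝ |
      (fun n : ℕ => ((matMul F n).rank : ℝ)) =O[atTop] (fun n : ℕ => (n : ℝ) ^ β)} := by
    intro k hk
    obtain ⟨n, hn⟩ : ∃ n, n = K ^ k := ⟨_, rfl⟩
    obtain ⟨δ, hδ⟩ : ∃ δ : ℝ, δ = 2 + 1 / k := ⟨_, rfl⟩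
    rw [← hδ]
    have hδ0 : 0 ≤ δ := by rw [hδ]; positivity
    have hn1 : 1 < n := hn ▸ Nat.one_lt_pow hk.ne' (by omega)
    have hKn : ((K * n ^ 2 : ℕ) : ℝ) = (n : ℝ) ^ δ := by
      have hn0 : (0 : ℝ) < n := by positivity
      rw [hδ, Real.rpow_add hn0, hn]
      push_cast
      rw [← Real.rpow_natCast_mul (by positivity) k (1 / k : ℝ), mul_one_div_cancel (by positivity),
        Real.rpow_one, Real.rpow_two, mul_comm]
    refine IsBigO.of_bound (n * (n : ℝ) ^ δ) ((eventually_gt_atTop 1).mono fun N hN => ?_)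
    rw [Real.norm_of_nonneg (by positivity), Real.norm_of_nonneg (by positivity)]
    set s := Nat.clog n N
    have hNs : N ≤ n ^ s := Nat.le_pow_clog hn1 N
    have hsN : n ^ s ≤ n * N := by
      have h1 := Nat.pow_pred_clog_lt_self hn1 hN
      have h2 : 0 < s := Nat.clog_pos hn1 hN
      calc n ^ s = n * n ^ (s - 1) := by rw [← pow_succ', Nat.sub_add_cancel h2]
        _ ≤ n * N := Nat.mul_le_mul_left _ h1.le
    have hr : (matMul F N).rank ≤ n * (K * n ^ 2) ^ s :=
      rank_matMul_le (by omega) (((h n (by omega)).pow s).comap (Function.Embedding.refl _)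
        (Fin.castLEEmb hNs))
    calc ((matMul F N).rank : ℝ) ≤ ((n * (K * n ^ 2) ^ s : ℕ) : ℝ) := by exact_mod_cast hr
      _ = n * ((n ^ s : ℕ) : ℝ) ^ δ := by
        rw [Nat.cast_mul, Nat.cast_pow, hKn, Nat.cast_pow, ← Real.rpow_natCast,
          ← Real.rpow_natCast, ← Real.rpow_mul (by positivity), ← Real.rpow_mul (by positivity),
          mul_comm δ]
      _ ≤ n * ((n * N : ℕ) : ℝ) ^ δ := by
        gcongr
      _ = n * (n : ℝ) ^ δ * (N : ℝ) ^ δ := by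
        rw [Nat.cast_mul, Real.mul_rpow (by positivity) (by positivity), mul_assoc]
  have hlow : ∀ β ∈ {β : ℝ |
      (fun n : ℕ => ((matMul F n).rank : ℝ)) =O[atTop] (fun n : ℕ => (n : ℝ) ^ β)}, 2 ≤ β :=
    fun β hβ => two_le_of_rank_isBigO F hβ
  refine le_antisymm (le_of_forall_pos_le_add fun ε hε => ?_)
    (le_csInf ⟨_, hmem 1 one_pos⟩ hlow)
  obtain ⟨k, hk⟩ := exists_nat_one_div_lt hε
  refine (csInf_le ⟨2, hlow⟩ (hmem (k + 1) k.succ_pos)).trans ?_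
  push_cast
  linarith

section LinearForms

open MvPolynomial

/-- The derivatives of a linear form are constant. -/
theorem pderiv_of_mem_span_X {F σ : Type*} [Field F] {l : MvPolynomial σ F}
    (hl : l ∈ Submodule.span F (Set.range (X : σ → MvPolynomial σ F))) (v : σ) :
    pderiv v l = C (constantCoeff (pderiv v l)) := by
  classical
  induction hl using Submodule.span_induction with
  | mem x hx =>
    obtain ⟨u, rfl⟩ := hx
    rw [pderiv_X, Pi.single_apply]
    split_ifs <;> simp
  | zero => simp
  | add x y _ _ hx hy => rw [map_add, map_add, map_add, ← hx, ← hy]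
  | smul c x _ hx =>
    rw [smul_eq_C_mul, pderiv_C_mul, map_mul, map_mul, ← hx]
    simp

/-- The third derivative of a product of three linear forms. -/
theorem constantCoeff_pderiv_mul {F σ : Type*} [Field F] {x y z : MvPolynomial σ F}
    (hx : x ∈ Submodule.span F (Set.range (X : σ → MvPolynomial σ F)))
    (hy : y ∈ Submodule.span F (Set.range (X : σ → MvPolynomial σ F)))
    (hz : z ∈ Submodule.span F (Set.range (X : σ → MvPolynomial σ F))) (u v w : σ) :
    constantCoeff (pderiv u (pderiv v (pderiv w (x * (y * z))))) =
      ∑ i : Fin 6, constantCoeff (pderiv u (![x, x, y, y, z, z] i)) *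
        constantCoeff (pderiv v (![y, z, x, z, x, y] i)) *
          constantCoeff (pderiv w (![z, y, z, x, y, x] i)) := by
  have ex := pderiv_of_mem_span_X hx
  have ey := pderiv_of_mem_span_X hy
  have ez := pderiv_of_mem_span_X hz
  generalize hX : (fun v => constantCoeff (pderiv v x)) = x' at *
  generalize hY : (fun v => constantCoeff (pderiv v y)) = y' at *
  generalize hZ : (fun v => constantCoeff (pderiv v z)) = z' at *
  have ex' : ∀ v, pderiv v x = C (x' v) := fun v => by rw [ex, ← hX]
  have ey' : ∀ v, pderiv v y = C (y' v) := fun v => by rw [ey, ← hY]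
  have ez' : ∀ v, pderiv v z = C (z' v) := fun v => by rw [ez, ← hZ]
  simp only [Fin.sum_univ_six]
  simp [ex', ey', ez']
  ring

end LinearForms

theorem coeff_three_mul {A : Type*} [CommRing A] (t u x y z : A) :
    (Polynomial.C t * (Polynomial.C u * (Polynomial.C x * Polynomial.X *
      (Polynomial.C y * Polynomial.X) * (Polynomial.C z * Polynomial.X)))).coeff 3 =
        t * u * (x * (y * z)) := by
  calc _ = (Polynomial.C (t * u * (x * (y * z))) * Polynomial.X ^ 3).coeff 3 := by
        congr 1
        simp only [map_mul]
        ring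
    _ = _ := by rw [Polynomial.coeff_C_mul_X_pow, if_pos rfl]

theorem constantCoeff_pderiv_X_mul (F : Type*) [Field F] {ι : Type} [DecidableEq ι]
    (p q r p' q' r' : ι) :
    MvPolynomial.constantCoeff (MvPolynomial.pderiv ((0 : Fin 3), p)
      (MvPolynomial.pderiv ((1 : Fin 3), q) (MvPolynomial.pderiv ((2 : Fin 3), r)
        (MvPolynomial.X ((0 : Fin 3), p') * (MvPolynomial.X ((1 : Fin 3), q') *
          MvPolynomial.X ((2 : Fin 3), r')) : MvPolynomial (Fin 3 × ι) F)))) =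
      if p' = p ∧ q' = q ∧ r' = r then 1 else 0 := by
  have hX : ∀ v, (MvPolynomial.X v : MvPolynomial (Fin 3 × ι) F) ∈ Submodule.span F
      (Set.range (MvPolynomial.X : Fin 3 × ι → MvPolynomial (Fin 3 × ι) F)) := fun v =>
    Submodule.subset_span ⟨v, rfl⟩
  rw [constantCoeff_pderiv_mul (hX _) (hX _) (hX _), Fin.sum_univ_six]
  by_cases h1 : p' = p <;> by_cases h2 : q' = q <;> by_cases h3 : r' = r <;>
    simp [h1, h2, h3, MvPolynomial.pderiv_X]

/-- A contraction of the first mode of a tensor with four modes has rank at most six times the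
circuit complexity of the tensor. -/
theorem exists_contraction_eq_sum {F : Type*} [Field F] {ι : Type} [Fintype ι]
    (T : Tensor F (fun _ : Fin 4 => ι)) {s : ℕ} (hs : T.CC ≤ s) (c : ι → F) :
    ∃ (W : Type) (_ : Fintype W) (x y z : W → ι → F), Fintype.card W ≤ 6 * s ∧
      ∀ p q r, ∑ o, c o * T ![o, p, q, r] = ∑ t, x t p * y t q * z t r := by
  classical
  obtain ⟨C, hC, hCs⟩ := Tensor.exists_circuit_of_CC_le hs
  let L := Submodule.span F
    (Set.range (MvPolynomial.X : Fin 3 × ι → MvPolynomial (Fin 3 × ι) F))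
  have hXL : ∀ v, (MvPolynomial.X v : MvPolynomial (Fin 3 × ι) F) ∈ L := fun v =>
    Submodule.subset_span ⟨v, rfl⟩
  let g : (Σ _ : Fin 4, ι) → Polynomial (MvPolynomial (Fin 3 × ι) F) := fun v =>
    Fin.cases (motive := fun _ => Polynomial (MvPolynomial (Fin 3 × ι) F))
      (Polynomial.C (algebraMap F _ (c v.2)))
      (fun i => Polynomial.C (MvPolynomial.X (i, v.2)) * Polynomial.X) v.1
  have g0 : ∀ a, g ⟨0, a⟩ = Polynomial.C (algebraMap F _ (c a)) := fun a => rfl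
  have gs : ∀ (i : Fin 3) a,
      g ⟨i.succ, a⟩ = Polynomial.C (MvPolynomial.X (i, a)) * Polynomial.X := fun i a => rfl
  obtain ⟨l, a, b, hl, ha, hb, h⟩ := C.exists_coeff_three_eq_sum hC (MvPolynomial.aeval g) L
    (by
      rintro ⟨j, t⟩
      rw [MvPolynomial.aeval_X]
      refine Fin.cases ?_ (fun i => ?_) j
      · exact ⟨c t, by rw [g0, Polynomial.coeff_C_zero]⟩
      · exact ⟨0, by simp [gs]⟩)
    (by
      rintro ⟨j, t⟩
      rw [MvPolynomial.aeval_X]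
      refine Fin.cases ?_ (fun i => ?_) j
      · rw [g0, Polynomial.coeff_C_of_ne_zero one_ne_zero]
        exact L.zero_mem
      · simpa [gs] using hXL (i, t))
    (by
      rintro ⟨j, t⟩
      rw [MvPolynomial.aeval_X]
      refine Fin.cases ?_ (fun i => ?_) j
      · simp [g0]
      · rw [gs]
        exact (Polynomial.natDegree_C_mul_le _ _).trans Polynomial.natDegree_X_le)
  have hT : (MvPolynomial.aeval g T.toPoly).coeff 3 = ∑ p : Fin 4 → ι,
      MvPolynomial.C (T p * c (p 0)) * (MvPolynomial.X ((0 : Fin 3), p 1) *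
        (MvPolynomial.X ((1 : Fin 3), p 2) * MvPolynomial.X ((2 : Fin 3), p 3))) := by
    simp only [Tensor.toPoly, map_sum, map_mul, map_prod, MvPolynomial.aeval_X,
      MvPolynomial.algHom_C, Polynomial.finsetSum_coeff]
    refine Finset.sum_congr rfl fun p _ => ?_
    rw [Fin.prod_univ_succ, Fin.prod_univ_three, g0, gs, gs, gs]
    have : algebraMap F (Polynomial (MvPolynomial (Fin 3 × ι) F)) (T p) =
      Polynomial.C (MvPolynomial.C (T p)) := rfl
    rw [this, coeff_three_mul, MvPolynomial.algebraMap_eq]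
    rfl
  let D : ι → ι → ι → MvPolynomial (Fin 3 × ι) F → F := fun p q r f =>
    MvPolynomial.constantCoeff (MvPolynomial.pderiv (0, p) (MvPolynomial.pderiv (1, q)
      (MvPolynomial.pderiv (2, r) f)))
  refine ⟨C.W × Fin 6, inferInstance,
    fun t p => MvPolynomial.constantCoeff (MvPolynomial.pderiv (0, p)
      (![l t.1, l t.1, a t.1, a t.1, b t.1, b t.1] t.2)),
    fun t p => MvPolynomial.constantCoeff (MvPolynomial.pderiv (1, p)
      (![a t.1, b t.1, l t.1, b t.1, l t.1, a t.1] t.2)),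
    fun t p => MvPolynomial.constantCoeff (MvPolynomial.pderiv (2, p)
      (![b t.1, a t.1, b t.1, l t.1, a t.1, l t.1] t.2)), ?_, fun p q r => ?_⟩
  · rw [Fintype.card_prod, Fintype.card_fin, mul_comm]
    exact Nat.mul_le_mul_left 6 hCs
  · have hX : ∀ p' q' r', D p q r (MvPolynomial.X (0, p') *
        (MvPolynomial.X (1, q') * MvPolynomial.X (2, r'))) =
          if p' = p ∧ q' = q ∧ r' = r then 1 else 0 :=
      constantCoeff_pderiv_X_mul F p q r
    have hD : D p q r (∑ p : Fin 4 → ι, MvPolynomial.C (T p * c (p 0)) *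
        (MvPolynomial.X ((0 : Fin 3), p 1) * (MvPolynomial.X ((1 : Fin 3), p 2) * MvPolynomial.X ((2 : Fin 3), p 3)))) =
          ∑ o, c o * T ![o, p, q, r] := by
      have : ∀ k : F, ∀ f, D p q r (MvPolynomial.C k * f) = k * D p q r f := fun k f => by
        simp [D]
      have hsum : ∀ f : (Fin 4 → ι) → MvPolynomial (Fin 3 × ι) F,
          D p q r (∑ p, f p) = ∑ t, D p q r (f t) := fun f => by simp [D]
      rw [hsum]
      simp only [this, hX]
      symm
      refine Fintype.sum_of_injective (fun o => ![o, p, q, r]) (fun o o' ho => ?_) _ _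
        (fun p' hp' => ?_) fun o => ?_
      · exact congrFun ho 0
      · rw [if_neg, mul_zero]
        rintro ⟨h1, h2, h3⟩
        refine hp' ⟨p' 0, ?_⟩
        funext j
        fin_cases j <;> simp [h1, h2, h3]
      · simp [mul_comm]
    rw [← hD, ← hT, h, Fintype.sum_prod_type]
    have hsum : ∀ f : C.W → MvPolynomial (Fin 3 × ι) F,
        D p q r (∑ w, f w) = ∑ t, D p q r (f t) := fun f => by simp [D]
    rw [hsum]
    exact Finset.sum_congr rfl fun w _ => constantCoeff_pderiv_mul (hl w) (ha w) (hb w) _ _ _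

/-- The pairing `01|23` of four modes. -/
def pairing₁ : Bool × Bool ≃ Fin 4 :=
  Equiv.ofBijective (fun x => bif x.1 then (bif x.2 then 3 else 2) else bif x.2 then 1 else 0)
    (by decide)

/-- The pairing `02|13` of four modes. -/
def pairing₂ : Bool × Bool ≃ Fin 4 :=
  Equiv.ofBijective (fun x => bif x.1 then (bif x.2 then 3 else 1) else bif x.2 then 2 else 0)
    (by decide)

/-- The pairing `03|12` of four modes. -/
def pairing₃ : Bool × Bool ≃ Fin 4 :=
  Equiv.ofBijective (fun x => bif x.1 then (bif x.2 then 2 else 1) else bif x.2 then 3 else 0)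
    (by decide)

theorem pairing_apply (F : Type*) [Field F] {ι : Type} [DecidableEq ι] (o p q r : ι) :
    pairing F ι pairing₁ ![o, p, q, r] = (if o = p ∧ q = r then 1 else 0) ∧
    pairing F ι pairing₂ ![o, p, q, r] = (if o = q ∧ p = r then 1 else 0) ∧
    pairing F ι pairing₃ ![o, p, q, r] = (if o = r ∧ p = q then 1 else 0) := by
  refine ⟨?_, ?_, ?_⟩ <;>
    simp [pairing, pairing₁, pairing₂, pairing₃, Bool.forall_bool]

/-- The product of the three pairings is a complete graph on four vertices; fixing one of the modes
leaves `n` disjoint `n × n` matrix multiplications. -/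
theorem matMulSumRankLE_of_CCSubmultiplicative {F : Type*} [Field F]
    (h : CCSubmultiplicative F 4) (n : ℕ) (hn : 0 < n) :
    MatMulSumRankLE F (Fin n) (Fin n) (n * (3072 * n ^ 2)) := by
  classical
  have : Nonempty (Fin n) := ⟨⟨0, hn⟩⟩
  let T₁ := pairing F (Fin n) pairing₁
  let T₂ := pairing F (Fin n) pairing₂
  let T₃ := pairing F (Fin n) pairing₃
  let E : Fin n × Fin n ↪ Fin (n * n) := finProdFinEquiv.toEmbedding
  let E' : Fin n ↪ Fin (n * n) := Fin.castLEEmb (Nat.le_mul_self n)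
  let B := (Tensor.extend (ι := Fin n × Fin n) E (T₁.kron T₂)).kron (T₃.extend E')
  have hCC : ∀ e, (pairing F (Fin n) e).CC ≤ ((8 * n : ℕ) : ℕ∞) := fun e =>
    (CC_pairing_le F (Fin n) e).trans (by rw [Fintype.card_fin]; exact_mod_cast (by omega))
  have h12 : (Tensor.extend (ι := Fin n × Fin n) E (T₁.kron T₂)).CC ≤
      ((8 * n * (8 * n) : ℕ) : ℕ∞) := by
    refine (Tensor.CC_extend_le (ι := Fin n × Fin n) E (T₁.kron T₂)).trans
      ((h n T₁ T₂).trans ?_)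
    rw [Nat.cast_mul]
    exact mul_le_mul' (hCC _) (hCC _)
  have hB : B.CC ≤ ((8 * n * (8 * n) * (8 * n) : ℕ) : ℕ∞) := by
    refine (h (n * n) _ _).trans ?_
    rw [Nat.cast_mul]
    exact mul_le_mul' h12 ((Tensor.CC_extend_le E' T₃).trans (hCC _))
  let m : (Fin n × Fin n) × Fin n → Fin (n * n) × Fin (n * n) := Prod.map E E'
  have hm : Function.Injective m := E.injective.prodMap E'.injective
  have hBm : ∀ o p q r, B ![m o, m p, m q, m r] =
      T₁ ![o.1.1, p.1.1, q.1.1, r.1.1] * T₂ ![o.1.2, p.1.2, q.1.2, r.1.2] *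
        T₃ ![o.2, p.2, q.2, r.2] := by
    intro o p q r
    have h1 := Tensor.extend_apply E (d := 4) (T₁.kron T₂) ![o.1, p.1, q.1, r.1]
    have h2 := Tensor.extend_apply E' T₃ ![o.2, p.2, q.2, r.2]
    have e1 : (fun j => (![m o, m p, m q, m r] j).1) =
        fun j => E (![o.1, p.1, q.1, r.1] j) := by
      funext j; fin_cases j <;> rfl
    have e2 : (fun j => (![m o, m p, m q, m r] j).2) =
        fun j => E' (![o.2, p.2, q.2, r.2] j) := by
      funext j; fin_cases j <;> rfl
    have e3 : (fun j => (![o.1, p.1, q.1, r.1] j).1) = ![o.1.1, p.1.1, q.1.1, r.1.1] := by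
      funext j; fin_cases j <;> rfl
    have e4 : (fun j => (![o.1, p.1, q.1, r.1] j).2) = ![o.1.2, p.1.2, q.1.2, r.1.2] := by
      funext j; fin_cases j <;> rfl
    simp only [B, Tensor.kron]
    rw [e1, e2, h2]
    refine congrArg (· * _) (h1.trans ?_)
    simp only [Tensor.kron]
    rw [e3, e4]
  let c : Fin (n * n) × Fin (n * n) → F := fun x => if ∃ i, m ((i, i), i) = x then 1 else 0
  have hc : ∀ p q r, ∑ o, c o * B ![o, p, q, r] = ∑ i, B ![m ((i, i), i), p, q, r] := by
    intro p q r
    symm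
    refine Fintype.sum_of_injective (fun i => m ((i, i), i)) (fun i j hij => ?_) _ _
      (fun x hx => ?_) fun i => ?_
    · exact congrArg Prod.snd (hm hij)
    · rw [show c x = 0 from if_neg hx, zero_mul]
    · rw [show c (m ((i, i), i)) = 1 from if_pos ⟨i, rfl⟩, one_mul]
  obtain ⟨W, _, x, y, z, hW, hxyz⟩ := exists_contraction_eq_sum B hB c
  refine MatMulSumRankLE.of_fintype (κ := W) (hW.trans (le_of_eq (by ring)))
    (fun t i a b => x t (m ((i, a), b))) (fun t j c d => y t (m ((d, j), c)))
    (fun t k e g => z t (m ((e, g), k))) fun i j k a b c d e g => ?_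
  rw [← hxyz, hc]
  simp only [hBm, T₁, T₂, T₃, (pairing_apply F _ _ _ _).1, (pairing_apply F _ _ _ _).2.1,
    (pairing_apply F _ _ _ _).2.2]
  constructor
  · rintro ⟨rfl, rfl, rfl, rfl, rfl⟩
    simp
  · intro h'
    refine Finset.sum_eq_zero fun o _ => ?_
    rw [ite_zero_mul_ite_zero, ite_zero_mul_ite_zero, if_neg]
    rintro ⟨⟨⟨rfl, h1⟩, h2, h3⟩, h4, h5⟩
    exact h' ⟨h2, h2.symm.trans h4, h5, h1.symm ▸ rfl, h3.symm⟩

end TensorComplexity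

end

theorem mainTheorem11 (F : Type*) [Field F] (h : TensorComplexity.CCSubmultiplicative F 4) :
    TensorComplexity.omega F = 2 :=
  TensorComplexity.omega_eq_two_of_rank_le F 3072 (by norm_num)
    (TensorComplexity.matMulSumRankLE_of_CCSubmultiplicative h)
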